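/- Let $A<0$, $B,C>0$, $s_+=\dfrac{B+\sqrt{B^2+24|A|C}}{4C}$, let $0<\epsilon<1$ and let $$\Omega=\{(x,y)\in\mathbb R^2:\ |x|<1,\ |y|<1,\ |x+y|<2-\epsilon,\ |x-y|<2-\epsilon\}$$ be the truncated square. For $L,\lambda>0$ and $L_2>-1$ consider, for $(q_1,q_2,q_3)\in W^{1,2}(\Omega;\mathbb R^3)$, the reduced Landau–de Gennes energy $$J[q_1,q_2,q_3]=\int_\Omega f_{el}+\frac{\lambda^2}{L}f_b\,\mathrm dA,$$ $$f_{el}=\Big(1+\frac{L_2}{2}\Big)\big(|\nabla q_1|^2+|\nabla q_2|^2\big)+\Big(3+\frac{L_2}{2}\Big)|\nabla q_3|^2+L_2\big(q_{1,y}q_{3,y}-q_{1,x}q_{3,x}-q_{2,y}q_{3,x}-q_{2,x}q_{3,y}\big)+|L_2|\big(q_{2,y}q_{1,x}-q_{1,y}q_{2,x}\big),$$ $$f_b=A(q_1^2+q_2^2+3q_3^2)+C(q_1^2+q_2^2+3q_3^2)^2+2Bq_3(q_1^2+q_2^2-q_3^2).$$ The triple $(q_1,q_2,q_3)$ represents the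 tensor field $\mathbf Q=q_1(\hat x\otimes\hat x-\hat y\otimes\hat y)+q_2(\hat x\otimes\hat y+\hat y\otimes\hat x)+q_3(2\hat z\otimes\hat z-\hat x\otimes\hat x-\hat y\otimes\hat y)$. Let $\mathcal A_0$ be the set of $(q_1,q_2,q_3)\in W^{1,2}(\Omega;\mathbb R^3)$ with $q_1=q_b$, $q_2=0$, $q_3=-s_+/6$ on $\partial\Omega$, where $q_b=s_+/2$ on the edges of $\Omega$ on $y=\pm1$, $q_b=-s_+/2$ on the edges on $x=\pm1$, and $q_b$ interpolates linearly between these values along each of the four short edges. Given constants $M_i=M_i(A,B,C)$, $i=1,2,3$, put $$\mathcal A_*=\Big\{(q_1,q_2,q_3)\in\mathcal A_0:\ \int_\Omega|\nabla q_i|^2\,\mathrm dA\le M_i(A,B,C),\ i=1,2,3\Big\}.$$ A critical point of $J$ is a triple at which the first variation of $J$ vanishes in every direction in $W^{1,2}_0(\Omega;\mathbb R^3)$; it is locally stable with respect to a class of perturbations $\mathbf V$ if the second variation $\frac{d^2}{dt^2}\big|_{t=0}J[\mathbf Q+t\mathbf V]$ exists and is positive for all $\mathbf V\neq0$ in the class.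 **Proposition 5.1.** There is a constant $c=c(A,B,C,\Omega)>0$, depending only on $A,B,C,\Omega$ (for given functions $M_1,M_2,M_3$), such that for all $L,\lambda>0$ and all $L_2\ge\frac{\lambda^2}{L}c(A,B,C,\Omega)$, every critical point of $J$ in $\mathcal A_*$ is locally stable with respect to the perturbations $$\mathbf V=v_1(\hat x\otimes\hat x-\hat y\otimes\hat y)+v_2(\hat x\otimes\hat y+\hat y\otimes\hat x),\qquad v_1,v_2\in W^{1,2}_0(\Omega),$$ and also with respect to the perturbations $$\mathbf V=v_3(2\hat z\otimes\hat z-\hat x\otimes\hat x-\hat y\otimes\hat y),\qquad v_3\in W^{1,2}_0(\Omega).$$ -/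

import Mathlib

open MeasureTheory Filter Topology
open scoped ContDiff NNReal

noncomputable section

namespace LdG

/-- The truncated square `{|x| < 1, |y| < 1, |x + y| < 2 - ε, |x - y| < 2 - ε}`. -/
def truncSq (ε : ℝ) : Set (ℝ × ℝ) :=
  {p | |p.1| < 1 ∧ |p.2| < 1 ∧ |p.1 + p.2| < 2 - ε ∧ |p.1 - p.2| < 2 - ε}

/-! ### The Sobolev spaces `W^{1,2}(Ω)` and `W_0^{1,2}(Ω)` -/

/-- Test functions on `Ω`: smooth, with compact support contained in `Ω`. -/
structure IsTest (Ω : Set (ℝ × ℝ)) (φ : ℝ × ℝ → ℝ) : Prop where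
  smooth : ContDiff ℝ ∞ φ
  compact : HasCompactSupport φ
  supp : tsupport φ ⊆ Ω

/-- An element of `W^{1,2}(Ω)`: a square integrable function `val` with square integrable weak
partial derivatives `dx`, `dy` (which are determined by `val` up to null sets). Only the values
on `Ω` matter. -/
structure Sobolev (Ω : Set (ℝ × ℝ)) where
  val : ℝ × ℝ → ℝ
  dx : ℝ × ℝ → ℝ
  dy : ℝ × ℝ → ℝ
  memLp_val : MemLp val 2 (volume.restrict Ω)
  memLp_dx : MemLp dx 2 (volume.restrict Ω)
  memLp_dy : MemLp dy 2 (volume.restrict Ω)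
  weak_dx : ∀ φ, IsTest Ω φ →
    ∫ p in Ω, val p * fderiv ℝ φ p (1, 0) = - ∫ p in Ω, dx p * φ p
  weak_dy : ∀ φ, IsTest Ω φ →
    ∫ p in Ω, val p * fderiv ℝ φ p (0, 1) = - ∫ p in Ω, dy p * φ p

variable {Ω : Set (ℝ × ℝ)}

theorem IsTest.memLp {φ : ℝ × ℝ → ℝ} (h : IsTest Ω φ) : MemLp φ 2 (volume.restrict Ω) :=
  h.smooth.continuous.memLp_of_hasCompactSupport h.compact

theorem IsTest.memLp_fderiv {φ : ℝ × ℝ → ℝ} (h : IsTest Ω φ) (v : ℝ × ℝ) :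
    MemLp (fun p => fderiv ℝ φ p v) 2 (volume.restrict Ω) := by
  have hc : Continuous (fun p => fderiv ℝ φ p v) :=
    (h.smooth.continuous_fderiv (by simp)).clm_apply continuous_const
  exact hc.memLp_of_hasCompactSupport (h.compact.fderiv_apply ℝ v)

theorem integral_add_mul_aux {f g k : ℝ × ℝ → ℝ} {μ : Measure (ℝ × ℝ)}
    (hf : MemLp f 2 μ) (hg : MemLp g 2 μ) (hk : MemLp k 2 μ) :
    ∫ p, (f p + g p) * k p ∂μ = (∫ p, f p * k p ∂μ) + ∫ p, g p * k p ∂μ := by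
  simp only [add_mul]
  exact integral_add (hf.integrable_mul hk) (hg.integrable_mul hk)

instance : Zero (Sobolev Ω) where
  zero :=
    { val := 0, dx := 0, dy := 0
      memLp_val := MemLp.zero
      memLp_dx := MemLp.zero
      memLp_dy := MemLp.zero
      weak_dx := by intro φ _; simp
      weak_dy := by intro φ _; simp }

instance : Add (Sobolev Ω) where
  add u v :=
    { val := fun p => u.val p + v.val p
      dx := fun p => u.dx p + v.dx p
      dy := fun p => u.dy p + v.dy p
      memLp_val := u.memLp_val.add v.memLp_val
      memLp_dx := u.memLp_dx.add v.memLp_dx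
      memLp_dy := u.memLp_dy.add v.memLp_dy
      weak_dx := by
        intro φ h
        rw [integral_add_mul_aux u.memLp_val v.memLp_val (h.memLp_fderiv _),
          integral_add_mul_aux u.memLp_dx v.memLp_dx h.memLp, u.weak_dx φ h, v.weak_dx φ h]
        ring
      weak_dy := by
        intro φ h
        rw [integral_add_mul_aux u.memLp_val v.memLp_val (h.memLp_fderiv _),
          integral_add_mul_aux u.memLp_dy v.memLp_dy h.memLp, u.weak_dy φ h, v.weak_dy φ h]
        ring }

instance : SMul ℝ (Sobolev Ω) where
  smul t u :=
    { val := fun p => t * u.val p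
      dx := fun p => t * u.dx p
      dy := fun p => t * u.dy p
      memLp_val := u.memLp_val.const_mul t
      memLp_dx := u.memLp_dx.const_mul t
      memLp_dy := u.memLp_dy.const_mul t
      weak_dx := by
        intro φ h
        simp only [mul_assoc, integral_const_mul, u.weak_dx φ h, mul_neg]
      weak_dy := by
        intro φ h
        simp only [mul_assoc, integral_const_mul, u.weak_dy φ h, mul_neg] }

/-- `u ∈ W_0^{1,2}(Ω)`: `u` is a limit of test functions in the norm of `W^{1,2}(Ω)`. -/
def InW0 (u : Sobolev Ω) : Prop :=
  ∃ φ : ℕ → ℝ × ℝ → ℝ, (∀ n, IsTest Ω (φ n)) ∧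
    Tendsto (fun n => eLpNorm (fun p => u.val p - φ n p) 2 (volume.restrict Ω)) atTop (𝓝 0) ∧
    Tendsto (fun n => eLpNorm (fun p => u.dx p - fderiv ℝ (φ n) p (1, 0)) 2
      (volume.restrict Ω)) atTop (𝓝 0) ∧
    Tendsto (fun n => eLpNorm (fun p => u.dy p - fderiv ℝ (φ n) p (0, 1)) 2
      (volume.restrict Ω)) atTop (𝓝 0)

/-- `u = w` on `∂Ω` in the sense of `W^{1,2}(Ω)`, that is, `u - w ∈ W_0^{1,2}(Ω)`. (On a Lipschitz
domain this is equality of traces, so only the boundary values of `w` matter.) -/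
def EqOnBoundary (u w : Sobolev Ω) : Prop := InW0 (u + (-1 : ℝ) • w)

/-- The Dirichlet energy `∫_Ω |∇u|²`. -/
def dirichlet (u : Sobolev Ω) : ℝ := ∫ p in Ω, (u.dx p ^ 2 + u.dy p ^ 2)

/-! ### Lipschitz functions as elements of `W^{1,2}` of the truncated square -/

theorem isOpen_truncSq (ε : ℝ) : IsOpen (truncSq ε) := by
  have h : truncSq ε = {p | |p.1| < 1} ∩ ({p | |p.2| < 1} ∩
      ({p | |p.1 + p.2| < 2 - ε} ∩ {p | |p.1 - p.2| < 2 - ε})) := rfl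
  rw [h]
  exact (isOpen_lt (by fun_prop) (by fun_prop)).inter
    ((isOpen_lt (by fun_prop) (by fun_prop)).inter
      ((isOpen_lt (by fun_prop) (by fun_prop)).inter (isOpen_lt (by fun_prop) (by fun_prop))))

theorem norm_le_of_mem_truncSq {ε : ℝ} {p : ℝ × ℝ} (hp : p ∈ truncSq ε) : ‖p‖ ≤ 1 := by
  rw [Prod.norm_def]
  exact max_le hp.1.le hp.2.1.le

theorem volume_truncSq_lt_top (ε : ℝ) : volume (truncSq ε) < ⊤ := by
  have h : truncSq ε ⊆ Metric.closedBall 0 1 := fun p hp => by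
    simpa using norm_le_of_mem_truncSq hp
  exact (measure_mono h).trans_lt measure_closedBall_lt_top

theorem weak_lineDeriv_aux {ε : ℝ} {f : ℝ × ℝ → ℝ} {K : ℝ≥0} (hf : LipschitzWith K f)
    (v : ℝ × ℝ) {φ : ℝ × ℝ → ℝ} (h : IsTest (truncSq ε) φ) :
    ∫ p in truncSq ε, f p * fderiv ℝ φ p v = - ∫ p in truncSq ε, lineDeriv ℝ f p v * φ p := by
  obtain ⟨D, hD⟩ := h.smooth.lipschitzWith_of_hasCompactSupport h.compact (by simp)
  have key := hf.integral_lineDeriv_mul_eq (μ := (volume : Measure (ℝ × ℝ))) hD h.compact v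
  have e1 : ∀ p, lineDeriv ℝ φ p (-v) * f p = -(f p * fderiv ℝ φ p v) := by
    intro p
    rw [((h.smooth.differentiable (by simp)).differentiableAt).lineDeriv_eq_fderiv, map_neg]
    ring
  simp only [e1, integral_neg] at key
  rw [setIntegral_eq_integral_of_forall_compl_eq_zero,
    setIntegral_eq_integral_of_forall_compl_eq_zero, key, neg_neg]
  · intro p hp
    rw [image_eq_zero_of_notMem_tsupport (fun hq => hp (h.supp hq)), mul_zero]
  · intro p hp
    have : p ∉ tsupport (fderiv ℝ φ) := fun hq => hp (h.supp (tsupport_fderiv_subset ℝ hq))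
    rw [image_eq_zero_of_notMem_tsupport this]
    simp

/-- A Lipschitz function, with its almost everywhere defined classical partial derivatives. -/
def ofLipschitz (ε : ℝ) (f : ℝ × ℝ → ℝ) (hf : ∃ K : ℝ≥0, LipschitzWith K f) :
    Sobolev (truncSq ε) :=
  have hfin : IsFiniteMeasure (volume.restrict (truncSq ε)) :=
    ⟨by simpa using volume_truncSq_lt_top ε⟩
  have hline : ∀ v : ℝ × ℝ,
      MemLp (fun p => lineDeriv ℝ f p v) 2 (volume.restrict (truncSq ε)) := by
    intro v
    obtain ⟨K, hK⟩ := hf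
    exact MemLp.of_bound (measurable_lineDeriv hK.continuous).aestronglyMeasurable (K * ‖v‖)
      (Eventually.of_forall fun p => norm_lineDeriv_le_of_lipschitz ℝ hK)
  { val := f
    dx := fun p => lineDeriv ℝ f p (1, 0)
    dy := fun p => lineDeriv ℝ f p (0, 1)
    memLp_val := by
      obtain ⟨K, hK⟩ := hf
      refine MemLp.of_bound hK.continuous.aestronglyMeasurable (‖f 0‖ + K * 1) ?_
      filter_upwards [ae_restrict_mem (isOpen_truncSq ε).measurableSet] with p hp
      have h1 := hK.norm_sub_le p 0
      have h2 := norm_le_of_mem_truncSq hp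
      have h3 : ‖f p‖ ≤ ‖f 0‖ + ‖f p - f 0‖ := by
        simpa using norm_add_le (f 0) (f p - f 0)
      rw [sub_zero] at h1
      have h4 : (K : ℝ) * ‖p‖ ≤ K * 1 := mul_le_mul_of_nonneg_left h2 K.2
      linarith
    memLp_dx := hline _
    memLp_dy := hline _
    weak_dx := by
      intro φ h
      obtain ⟨K, hK⟩ := hf
      exact weak_lineDeriv_aux hK _ h
    weak_dy := by
      intro φ h
      obtain ⟨K, hK⟩ := hf
      exact weak_lineDeriv_aux hK _ h }

/-! ### Boundary data -/

/-- The equilibrium order parameter `s₊ = (B + √(B² + 24|A|C)) / (4C)`. -/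
def sPlus (A B C : ℝ) : ℝ := (B + √(B ^ 2 + 24 * |A| * C)) / (4 * C)

/-- The interpolation `g(l) = s₊ l / (2ε)` used on the short edges. -/
def gInterp (ε s l : ℝ) : ℝ := s / (2 * ε) * l

/-- The boundary datum `q_b` on `∂Ω`, edge by edge: `s₊/2` on the edges on `y = ±1`, `-s₊/2` on
the edges on `x = ±1`, and linear interpolation on the short edges (listed clockwise from the
top-left one). -/
def qb (ε s : ℝ) (p : ℝ × ℝ) : ℝ :=
  if p.2 = 1 ∨ p.2 = -1 then s / 2
  else if p.1 = 1 ∨ p.1 = -1 then -s / 2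
  else if p.2 - p.1 = 2 - ε then gInterp ε s (p.1 + p.2)
  else if p.1 + p.2 = 2 - ε then gInterp ε s (p.2 - p.1)
  else if p.1 - p.2 = 2 - ε then gInterp ε s (-p.1 - p.2)
  else gInterp ε s (p.1 - p.2)

/-- A Lipschitz function on the plane which equals `q_b` on `∂Ω`
(see `qbExt_eq_qb`). -/
def qbExt (ε s : ℝ) (p : ℝ × ℝ) : ℝ :=
  gInterp ε s (max (-ε) (min ε (|p.2| - |p.1|)))

theorem qbExt_lipschitz (ε s : ℝ) : ∃ K : ℝ≥0, LipschitzWith K (qbExt ε s) := by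
  have h1 : LipschitzWith (1 * 1) (fun p : ℝ × ℝ => |p.1|) :=
    lipschitzWith_one_norm.comp LipschitzWith.prod_fst
  have h2 : LipschitzWith (1 * 1) (fun p : ℝ × ℝ => |p.2|) :=
    lipschitzWith_one_norm.comp LipschitzWith.prod_snd
  exact ⟨_, (lipschitzWith_smul (s / (2 * ε))).comp (((h2.sub h1).const_min ε).const_max (-ε))⟩

/-- `qbExt` has the prescribed values on the boundary. -/
theorem qbExt_eq_qb {ε : ℝ} (h0 : 0 < ε) (h1 : ε < 1) (s : ℝ) {p : ℝ × ℝ}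
    (hp : p ∈ frontier (truncSq ε)) : qbExt ε s p = qb ε s p := by
  have hcl : p ∈ {p : ℝ × ℝ | |p.1| ≤ 1 ∧ |p.2| ≤ 1 ∧ |p.1 + p.2| ≤ 2 - ε ∧
      |p.1 - p.2| ≤ 2 - ε} := by
    refine closure_minimal (t := {p : ℝ × ℝ | |p.1| ≤ 1 ∧ |p.2| ≤ 1 ∧ |p.1 + p.2| ≤ 2 - ε ∧
      |p.1 - p.2| ≤ 2 - ε}) (fun q hq => ⟨hq.1.le, hq.2.1.le, hq.2.2.1.le, hq.2.2.2.le⟩) ?_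
      (frontier_subset_closure hp)
    have e : {p : ℝ × ℝ | |p.1| ≤ 1 ∧ |p.2| ≤ 1 ∧ |p.1 + p.2| ≤ 2 - ε ∧ |p.1 - p.2| ≤ 2 - ε}
        = {p | |p.1| ≤ 1} ∩ ({p | |p.2| ≤ 1} ∩
          ({p | |p.1 + p.2| ≤ 2 - ε} ∩ {p | |p.1 - p.2| ≤ 2 - ε})) := rfl
    rw [e]
    exact (isClosed_le (by fun_prop) (by fun_prop)).inter
      ((isClosed_le (by fun_prop) (by fun_prop)).inter
        ((isClosed_le (by fun_prop) (by fun_prop)).inter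
          (isClosed_le (by fun_prop) (by fun_prop))))
  have hnot : p ∉ truncSq ε := by
    rw [(isOpen_truncSq ε).frontier_eq] at hp
    exact hp.2
  obtain ⟨x, y⟩ := p
  have hε : ε ≠ 0 := h0.ne'
  have e1 : s / (2 * ε) * ε = s / 2 := by field_simp
  simp only [truncSq, Set.mem_ofPred_eq, not_and_or, not_lt, abs_le, le_abs] at hcl hnot
  simp only [qbExt, qb]
  have top : ε ≤ |y| - |x| → gInterp ε s (max (-ε) (min ε (|y| - |x|))) = s / 2 := by
    intro h
    rw [min_eq_left h, max_eq_right (by linarith), gInterp, e1]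
  have bot : |y| - |x| ≤ -ε → gInterp ε s (max (-ε) (min ε (|y| - |x|))) = -s / 2 := by
    intro h
    rw [min_eq_right (by linarith), max_eq_left h, gInterp]
    linarith
  have mid : ∀ l, |y| - |x| = l → -ε ≤ l → l ≤ ε →
      gInterp ε s (max (-ε) (min ε (|y| - |x|))) = gInterp ε s l := by
    intro l h ha hb
    rw [h, min_eq_right hb, max_eq_right ha]
  split_ifs with c1 c2 c3 c4 c5
  · apply top
    rcases c1 with rfl | rfl <;> rcases abs_cases x with h | h <;> simp <;> linarith
  · apply bot
    rcases c2 with rfl | rfl <;> rcases abs_cases y with h | h <;> simp <;> linarith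
  · apply mid <;> (try rw [abs_of_nonneg (by linarith : 0 ≤ y), abs_of_nonpos (by linarith : x ≤ 0)])
      <;> linarith
  · apply mid <;> (try rw [abs_of_nonneg (by linarith : 0 ≤ y), abs_of_nonneg (by linarith : 0 ≤ x)])
      <;> linarith
  · apply mid <;> (try rw [abs_of_nonpos (by linarith : y ≤ 0), abs_of_nonneg (by linarith : 0 ≤ x)])
      <;> linarith
  · push Not at c1 c2
    have hx : x < 1 ∧ -1 < x := ⟨lt_of_le_of_ne (by linarith) c2.1,
      lt_of_le_of_ne (by linarith) (Ne.symm c2.2)⟩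
    have hy : y < 1 ∧ -1 < y := ⟨lt_of_le_of_ne (by linarith) c1.1,
      lt_of_le_of_ne (by linarith) (Ne.symm c1.2)⟩
    have c6 : x + y = -(2 - ε) := by
      rcases hnot with (h | h) | (h | h) | (h | h) | (h | h)
      · linarith
      · linarith
      · linarith
      · linarith
      · exact absurd (le_antisymm (by linarith) h) c4
      · linarith
      · exact absurd (le_antisymm (by linarith) h) c5
      · exact absurd (le_antisymm (by linarith) (by linarith)) c3
    apply mid <;> (try rw [abs_of_nonpos (by linarith : y ≤ 0), abs_of_nonpos (by linarith : x ≤ 0)])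
      <;> linarith

/-- The boundary datum for `q₁`, as an element of `W^{1,2}(Ω)`. -/
def qbSobolev (ε s : ℝ) : Sobolev (truncSq ε) := ofLipschitz ε (qbExt ε s) (qbExt_lipschitz ε s)

/-- A constant function, as an element of `W^{1,2}(Ω)`. -/
def constSobolev (ε a : ℝ) : Sobolev (truncSq ε) :=
  ofLipschitz ε (fun _ => a) ⟨0, LipschitzWith.const a⟩

/-! ### The reduced Landau-de Gennes energy -/

/-- A triple `(q₁, q₂, q₃) ∈ W^{1,2}(Ω; ℝ³)`, standing for the tensor field
`q₁ (x⊗x - y⊗y) + q₂ (x⊗y + y⊗x) + q₃ (2 z⊗z - x⊗x - y⊗y)`. -/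
structure Triple (Ω : Set (ℝ × ℝ)) where
  q₁ : Sobolev Ω
  q₂ : Sobolev Ω
  q₃ : Sobolev Ω

/-- The perturbed triple `q + t v`. -/
def Triple.perturb (q : Triple Ω) (t : ℝ) (v : Triple Ω) : Triple Ω :=
  ⟨q.q₁ + t • v.q₁, q.q₂ + t • v.q₂, q.q₃ + t • v.q₃⟩

/-- The elastic energy density. -/
def elastic (L₂ : ℝ) (q : Triple Ω) (p : ℝ × ℝ) : ℝ :=
  (1 + L₂ / 2) * (q.q₁.dx p ^ 2 + q.q₁.dy p ^ 2)
    + (1 + L₂ / 2) * (q.q₂.dx p ^ 2 + q.q₂.dy p ^ 2)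
    + (3 + L₂ / 2) * (q.q₃.dx p ^ 2 + q.q₃.dy p ^ 2)
    + L₂ * (q.q₁.dy p * q.q₃.dy p - q.q₁.dx p * q.q₃.dx p
        - q.q₂.dy p * q.q₃.dx p - q.q₂.dx p * q.q₃.dy p)
    + |L₂| * (q.q₂.dy p * q.q₁.dx p - q.q₁.dy p * q.q₂.dx p)

/-- The bulk (thermotropic) energy density. -/
def bulk (A B C a b c : ℝ) : ℝ :=
  A * (a ^ 2 + b ^ 2 + 3 * c ^ 2) + C * (a ^ 2 + b ^ 2 + 3 * c ^ 2) ^ 2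
    + 2 * B * c * (a ^ 2 + b ^ 2 - c ^ 2)

/-- The reduced Landau-de Gennes energy `J[q₁, q₂, q₃]`. -/
def J (A B C L lam L₂ : ℝ) (q : Triple Ω) : ℝ :=
  ∫ p in Ω, (elastic L₂ q p
    + lam ^ 2 / L * bulk A B C (q.q₁.val p) (q.q₂.val p) (q.q₃.val p))

/-- The admissible class `A_0`: `q₁ = q_b`, `q₂ = 0`, `q₃ = -s₊/6` on `∂Ω`. -/
def A0 (A B C ε : ℝ) : Set (Triple (truncSq ε)) :=
  {q | EqOnBoundary q.q₁ (qbSobolev ε (sPlus A B C)) ∧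
    EqOnBoundary q.q₂ (constSobolev ε 0) ∧
    EqOnBoundary q.q₃ (constSobolev ε (-sPlus A B C / 6))}

/-- The restricted class `A_*`, with Dirichlet energies bounded by `m₁`, `m₂`, `m₃`. -/
def AStar (A B C ε m₁ m₂ m₃ : ℝ) : Set (Triple (truncSq ε)) :=
  {q | q ∈ A0 A B C ε ∧ dirichlet q.q₁ ≤ m₁ ∧ dirichlet q.q₂ ≤ m₂ ∧ dirichlet q.q₃ ≤ m₃}

/-- `q` is a critical point of `J`: the first variation vanishes for all perturbations in
`W_0^{1,2}(Ω; ℝ³)`. -/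
def IsCritical (A B C L lam L₂ : ℝ) (q : Triple Ω) : Prop :=
  ∀ v : Triple Ω, InW0 v.q₁ → InW0 v.q₂ → InW0 v.q₃ →
    HasDerivAt (fun t : ℝ => J A B C L lam L₂ (q.perturb t v)) 0 0

/-- The second variation of `J` at `q` in the direction `v` exists and is positive. -/
def PosSecondVariation (A B C L lam L₂ : ℝ) (q v : Triple Ω) : Prop :=
  ContDiffAt ℝ 2 (fun t : ℝ => J A B C L lam L₂ (q.perturb t v)) 0 ∧
    0 < iteratedDeriv 2 (fun t : ℝ => J A B C L lam L₂ (q.perturb t v)) 0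

/-- `u` is the zero element of `W^{1,2}(Ω)`, i.e. it vanishes almost everywhere in `Ω`. -/
def AEZero (u : Sobolev Ω) : Prop := ∀ᵐ p ∂(volume.restrict Ω), u.val p = 0

/-- Local stability with respect to the in-plane perturbations
`v₁ (x⊗x - y⊗y) + v₂ (x⊗y + y⊗x)` vanishing on the boundary. -/
def StableInPlane (A B C L lam L₂ : ℝ) (q : Triple Ω) : Prop :=
  ∀ v₁ v₂ : Sobolev Ω, InW0 v₁ → InW0 v₂ → ¬ (AEZero v₁ ∧ AEZero v₂) →
    PosSecondVariation A B C L lam L₂ q ⟨v₁, v₂, 0⟩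

/-- Local stability with respect to the out-of-plane perturbations
`v₃ (2 z⊗z - x⊗x - y⊗y)` vanishing on the boundary. -/
def StableOutOfPlane (A B C L lam L₂ : ℝ) (q : Triple Ω) : Prop :=
  ∀ v₃ : Sobolev Ω, InW0 v₃ → ¬ AEZero v₃ →
    PosSecondVariation A B C L lam L₂ q ⟨0, 0, v₃⟩

end LdG

end

noncomputable section

namespace LdG

variable {Ω : Set (ℝ × ℝ)}

/-! ### Sobolev and Poincaré inequalities on `W_0^{1,2}` -/

/-! Along a line `q + t v` the energy is a quartic polynomial in `t`, so the second variation is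
twice the integral of the `t ^ 2` coefficient (`secondVariation`), provided all terms are
integrable. The quartic bulk term asks for `L⁴`; this holds because boundary data are Lipschitz and
the Gagliardo–Nirenberg–Sobolev inequality puts `W_0^{1,2}` of a bounded plane set into `L⁴`
(`memLpFour_of_mem_A0`).

For `L₂ ≥ 0` the elastic part of the second variation is at least `(2 + L₂) ∫ |∇v|²`. In-plane, the
cross term `v₂,y v₁,x - v₁,y v₂,x` is a null Lagrangian and integrates to zero
(`integral_nullLagrangian`); in both classes the coupling terms with coefficient `L₂` disappear,
since each pairs an in-plane component with the third.

The bulk part is at least `-(λ²/L) K |v|²` with `K = bulkConst A B C`, uniformly in `q`: the cubic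
term contributes something linear in `q₃`, which the nonnegative quadratic contribution of the
quartic term absorbs on completing the square (`inPlane_density_ge`, `outOfPlane_density_ge`). With
a Poincaré constant `P` (`exists_poincare`), the condition `(λ²/L) K P ≤ L₂` lets `L₂ ∫ |∇v|²` pay
for the bulk, and `2 ∫ |∇v|² > 0` remains. -/

theorem norm_fderiv_le_add (φ : ℝ × ℝ → ℝ) (p : ℝ × ℝ) :
    ‖fderiv ℝ φ p‖ ≤ ‖fderiv ℝ φ p (1, 0)‖ + ‖fderiv ℝ φ p (0, 1)‖ := by
  refine ContinuousLinearMap.opNorm_le_bound _ (by positivity) fun x => ?_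
  have e : x = x.1 • ((1 : ℝ), (0 : ℝ)) + x.2 • ((0 : ℝ), (1 : ℝ)) := by
    ext <;> simp
  have h1 : ‖x.1‖ ≤ ‖x‖ := norm_fst_le x
  have h2 : ‖x.2‖ ≤ ‖x‖ := norm_snd_le x
  have e2 : fderiv ℝ φ p x = x.1 * fderiv ℝ φ p (1, 0) + x.2 * fderiv ℝ φ p (0, 1) := by
    conv_lhs => rw [e]
    rw [map_add, map_smul, map_smul, smul_eq_mul, smul_eq_mul]
  rw [e2]
  calc _ ≤ ‖x.1 * fderiv ℝ φ p (1, 0)‖ + ‖x.2 * fderiv ℝ φ p (0, 1)‖ := norm_add_le _ _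
    _ = ‖x.1‖ * ‖fderiv ℝ φ p (1, 0)‖ + ‖x.2‖ * ‖fderiv ℝ φ p (0, 1)‖ := by
        rw [norm_mul, norm_mul]
    _ ≤ ‖x‖ * ‖fderiv ℝ φ p (1, 0)‖ + ‖x‖ * ‖fderiv ℝ φ p (0, 1)‖ := by gcongr
    _ = _ := by ring

/-- In the plane the Sobolev conjugate of `4/3` is `4`, as `1/4 = 3/4 - 1/2`; the hypothesis on `q`
says `0 < q ≤ 4`. The exponent `4/3` is raised to `2` by Hölder on the bounded set. The case `q = 4`
serves integrability, the case `q = 2` gives Poincaré. -/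
theorem IsTest.exists_eLpNorm_le (hb : Bornology.IsBounded Ω)
    {q : ℝ≥0} (hq : (1 / 4 : ℝ) ≤ (q : ℝ)⁻¹) :
    ∃ K : ℝ≥0, ∀ φ, IsTest Ω φ → eLpNorm φ q (volume.restrict Ω) ≤
      K * (eLpNorm (fun p => fderiv ℝ φ p (1, 0)) 2 (volume.restrict Ω)
        + eLpNorm (fun p => fderiv ℝ φ p (0, 1)) 2 (volume.restrict Ω)) := by
  have hfin : volume Ω ≠ ⊤ := hb.measure_lt_top.ne
  -- The Hölder factor `|Ω|^(3/4 - 1/2)` for passing from `L²` to `L^{4/3}`.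
  set V : ENNReal := volume Ω ^ (1 / (4 / 3 : ENNReal).toReal - 1 / (2 : ENNReal).toReal) with hV
  have hVtop : V ≠ ⊤ := by
    refine ENNReal.rpow_ne_top_of_nonneg ?_ hfin
    norm_num
  let K₀ := eLpNormLESNormFDerivOfLeConst ℝ (volume : Measure (ℝ × ℝ)) Ω (4 / 3) q
  refine ⟨K₀ * V.toNNReal, fun φ h => ?_⟩
  have h43 : ((4 / 3 : ℝ≥0) : ENNReal) = 4 / 3 := by
    rw [ENNReal.coe_div (by norm_num)]; norm_num
  have hsupp : Function.support φ ⊆ Ω := (subset_tsupport φ).trans h.supp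
  have hsupp' : Function.support (fderiv ℝ φ) ⊆ Ω :=
    (subset_tsupport _).trans ((tsupport_fderiv_subset ℝ).trans h.supp)
  have gns := eLpNorm_le_eLpNorm_fderiv_of_le (volume : Measure (ℝ × ℝ)) (u := φ) (s := Ω)
    (p := 4 / 3) (q := q) (h.smooth.of_le (by simp)) hsupp
    (by rw [← NNReal.coe_le_coe]; norm_num) (by rw [← NNReal.coe_lt_coe]; norm_num)
    (le_trans (by norm_num) hq) hb
  rw [h43] at gns
  have hm : AEStronglyMeasurable (fderiv ℝ φ) (volume.restrict Ω) :=
    (h.smooth.continuous_fderiv (by simp)).aestronglyMeasurable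
  have hr : eLpNorm (fderiv ℝ φ) (4 / 3) volume
      = eLpNorm (fderiv ℝ φ) (4 / 3) (volume.restrict Ω) :=
    (eLpNorm_restrict_eq_of_support_subset (f := fderiv ℝ φ) hsupp').symm
  have hholder : eLpNorm (fderiv ℝ φ) (4 / 3) (volume.restrict Ω)
      ≤ eLpNorm (fderiv ℝ φ) 2 (volume.restrict Ω) * V := by
    have := eLpNorm_le_eLpNorm_mul_rpow_measure_univ (p := (4 / 3 : ENNReal)) (q := 2)
      (by rw [← h43, ← ENNReal.coe_ofNat, ENNReal.coe_le_coe, ← NNReal.coe_le_coe]; norm_num) hm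
    simpa [hV] using this
  have hsum : eLpNorm (fderiv ℝ φ) 2 (volume.restrict Ω) ≤
      eLpNorm (fun p => fderiv ℝ φ p (1, 0)) 2 (volume.restrict Ω)
        + eLpNorm (fun p => fderiv ℝ φ p (0, 1)) 2 (volume.restrict Ω) := by
    have h1 := (h.memLp_fderiv (1, 0)).norm
    have h2 := (h.memLp_fderiv (0, 1)).norm
    have h3 := eLpNorm_mono_real (p := 2) (μ := volume.restrict Ω) (norm_fderiv_le_add φ)
    refine h3.trans ((eLpNorm_add_le h1.1 h2.1 (by norm_num)).trans_eq ?_)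
    rw [eLpNorm_norm, eLpNorm_norm]
  calc eLpNorm φ q (volume.restrict Ω) ≤ eLpNorm φ q volume :=
        eLpNorm_mono_measure _ Measure.restrict_le_self
    _ ≤ K₀ * eLpNorm (fderiv ℝ φ) (4 / 3) volume := gns
    _ ≤ K₀ * (eLpNorm (fderiv ℝ φ) 2 (volume.restrict Ω) * V) := by rw [hr]; gcongr
    _ = (K₀ * V) * eLpNorm (fderiv ℝ φ) 2 (volume.restrict Ω) := by ring
    _ ≤ (K₀ * V) * _ := mul_le_mul' le_rfl hsum
    _ = _ := by rw [ENNReal.coe_mul, ENNReal.coe_toNNReal hVtop]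

theorem eLpNorm_le_add_sub {f g : ℝ × ℝ → ℝ} {μ : Measure (ℝ × ℝ)} (hf : MemLp f 2 μ)
    (hg : MemLp g 2 μ) : eLpNorm g 2 μ ≤ eLpNorm f 2 μ + eLpNorm (fun p => f p - g p) 2 μ := by
  have h := eLpNorm_sub_le hf.1 (hf.sub hg).1 (p := 2) (by norm_num)
  have e : f - (f - g) = g := sub_sub_cancel f g
  rw [e] at h
  exact h

/-- The approximating test functions converge only in `L²`, which need not control the `L^q` norm. A
subsequence converges almost everywhere, and Fatou gives lower semicontinuity of the `L^q` norm,
while the gradient norms on the right converge. -/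
theorem exists_eLpNorm_le_of_inW0 (hb : Bornology.IsBounded Ω)
    {q : ℝ≥0} (hq : (1 / 4 : ℝ) ≤ (q : ℝ)⁻¹) :
    ∃ K : ℝ≥0, ∀ u : Sobolev Ω, InW0 u → eLpNorm u.val q (volume.restrict Ω) ≤
      K * (eLpNorm u.dx 2 (volume.restrict Ω) + eLpNorm u.dy 2 (volume.restrict Ω)) := by
  obtain ⟨K, hK⟩ := IsTest.exists_eLpNorm_le hb hq
  refine ⟨K, ?_⟩
  rintro u ⟨φ, hφ, h0, hx, hy⟩
  have hmeas : TendstoInMeasure (volume.restrict Ω) φ atTop u.val := by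
    refine tendstoInMeasure_of_tendsto_eLpNorm (p := 2) (by norm_num)
      (fun n => (hφ n).memLp.1) u.memLp_val.1 ?_
    refine h0.congr fun n => ?_
    rw [← eLpNorm_neg]
    congr 1
    ext p
    simp
  obtain ⟨ns, hns, hae⟩ := hmeas.exists_seq_tendsto_ae
  refine (Lp.eLpNorm_lim_le_liminf_eLpNorm (fun n => (hφ (ns n)).memLp.1) _ hae).trans ?_
  set ex := fun n => eLpNorm (fun p => u.dx p - fderiv ℝ (φ n) p (1, 0)) 2 (volume.restrict Ω)
  set ey := fun n => eLpNorm (fun p => u.dy p - fderiv ℝ (φ n) p (0, 1)) 2 (volume.restrict Ω)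
  set X := eLpNorm u.dx 2 (volume.restrict Ω)
  set Y := eLpNorm u.dy 2 (volume.restrict Ω)
  have hlim : Tendsto (fun n => (K : ENNReal) * ((X + ex (ns n)) + (Y + ey (ns n)))) atTop
      (𝓝 (K * ((X + 0) + (Y + 0)))) := by
    refine ENNReal.Tendsto.const_mul ?_ (Or.inr ENNReal.coe_ne_top)
    exact ((tendsto_const_nhds.add (hx.comp hns.tendsto_atTop))).add
      (tendsto_const_nhds.add (hy.comp hns.tendsto_atTop))
  rw [add_zero, add_zero] at hlim
  rw [← hlim.liminf_eq]
  refine liminf_le_liminf (Eventually.of_forall fun n => ?_)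
  refine (hK _ (hφ (ns n))).trans ?_
  gcongr
  · exact eLpNorm_le_add_sub u.memLp_dx ((hφ (ns n)).memLp_fderiv _)
  · exact eLpNorm_le_add_sub u.memLp_dy ((hφ (ns n)).memLp_fderiv _)

theorem InW0.memLp_four (hb : Bornology.IsBounded Ω) {u : Sobolev Ω}
    (hu : InW0 u) : MemLp u.val 4 (volume.restrict Ω) := by
  obtain ⟨K, hK⟩ := exists_eLpNorm_le_of_inW0 hb (q := 4) (by norm_num)
  refine ⟨u.memLp_val.1, lt_of_le_of_lt (hK u hu) ?_⟩
  exact ENNReal.mul_lt_top ENNReal.coe_lt_top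
    (ENNReal.add_lt_top.2 ⟨u.memLp_dx.2, u.memLp_dy.2⟩)

theorem toReal_eLpNorm_two_sq {f : ℝ × ℝ → ℝ} {μ : Measure (ℝ × ℝ)} (hf : MemLp f 2 μ) :
    (eLpNorm f 2 μ).toReal ^ 2 = ∫ p, f p ^ 2 ∂μ := by
  rw [hf.eLpNorm_eq_integral_rpow_norm (by norm_num) (by norm_num)]
  have h0 : 0 ≤ ∫ p, f p ^ 2 ∂μ := integral_nonneg fun p => sq_nonneg _
  have e : ∫ p, ‖f p‖ ^ (2 : ENNReal).toReal ∂μ = ∫ p, f p ^ 2 ∂μ := by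
    congr 1
    ext p
    simp
  rw [e, ENNReal.toReal_ofReal (by positivity)]
  rw [show (2 : ENNReal).toReal⁻¹ = (1 / 2 : ℝ) by norm_num, ← Real.sqrt_eq_rpow, Real.sq_sqrt h0]

theorem Sobolev.dirichlet_eq_add (u : Sobolev Ω) :
    dirichlet u = (∫ p in Ω, u.dx p ^ 2) + ∫ p in Ω, u.dy p ^ 2 :=
  integral_add u.memLp_dx.integrable_sq u.memLp_dy.integrable_sq

theorem dirichlet_nonneg (u : Sobolev Ω) : 0 ≤ dirichlet u :=
  integral_nonneg fun _ => by positivity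

/-- The Poincaré inequality. -/
theorem exists_poincare (hb : Bornology.IsBounded Ω) :
    ∃ P : ℝ, 0 ≤ P ∧ ∀ u : Sobolev Ω, InW0 u → ∫ p in Ω, u.val p ^ 2 ≤ P * dirichlet u := by
  obtain ⟨K, hK⟩ := exists_eLpNorm_le_of_inW0 hb (q := 2) (by norm_num)
  -- The factor `2` comes from `(X + Y)² ≤ 2 (X² + Y²)`, with `X`, `Y` the norms of the two partial
  -- derivatives.
  refine ⟨2 * K ^ 2, by positivity, fun u hu => ?_⟩
  have h := ENNReal.toReal_mono (ENNReal.mul_ne_top ENNReal.coe_ne_top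
    (ENNReal.add_ne_top.2 ⟨u.memLp_dx.2.ne, u.memLp_dy.2.ne⟩)) (hK u hu)
  rw [ENNReal.toReal_mul, ENNReal.toReal_add u.memLp_dx.2.ne u.memLp_dy.2.ne] at h
  rw [u.dirichlet_eq_add, ← toReal_eLpNorm_two_sq u.memLp_val, ← toReal_eLpNorm_two_sq u.memLp_dx,
    ← toReal_eLpNorm_two_sq u.memLp_dy]
  simp only [ENNReal.coe_toReal, ENNReal.coe_ofNat] at h
  set X := (eLpNorm u.dx 2 (volume.restrict Ω)).toReal
  set Y := (eLpNorm u.dy 2 (volume.restrict Ω)).toReal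
  calc _ ≤ ((K : ℝ) * (X + Y)) ^ 2 := pow_le_pow_left₀ ENNReal.toReal_nonneg h 2
    _ = (K : ℝ) ^ 2 * (X + Y) ^ 2 := by ring
    _ ≤ (K : ℝ) ^ 2 * (2 * (X ^ 2 + Y ^ 2)) := by gcongr; nlinarith [sq_nonneg (X - Y)]
    _ = _ := by ring

/-- By Poincaré, zero Dirichlet energy would force `u` to vanish almost everywhere. This makes the
final inequality strict. -/
theorem dirichlet_pos_of_not_aeZero (hb : Bornology.IsBounded Ω)
    {u : Sobolev Ω} (hu : InW0 u) (h : ¬ AEZero u) : 0 < dirichlet u := by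
  obtain ⟨P, -, hP⟩ := exists_poincare hb
  refine lt_of_le_of_ne (dirichlet_nonneg u) fun h0 => h ?_
  have h1 := hP u hu
  rw [← h0, mul_zero] at h1
  have h2 : ∫ p in Ω, u.val p ^ 2 = 0 := le_antisymm h1 (integral_nonneg fun _ => sq_nonneg _)
  rw [integral_eq_zero_iff_of_nonneg (fun _ => sq_nonneg _) u.memLp_val.integrable_sq] at h2
  filter_upwards [h2] with p hp
  simpa using hp

/-! ### The null Lagrangian -/

/-- By Hölder, `f * gn` converges to `f * g` in `L¹`. -/
theorem tendsto_integral_mul {f g : ℝ × ℝ → ℝ} {gn : ℕ → ℝ × ℝ → ℝ} {μ : Measure (ℝ × ℝ)}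
    (hf : MemLp f 2 μ) (hg : MemLp g 2 μ) (hgn : ∀ n, MemLp (gn n) 2 μ)
    (h : Tendsto (fun n => eLpNorm (fun p => g p - gn n p) 2 μ) atTop (𝓝 0)) :
    Tendsto (fun n => ∫ p, f p * gn n p ∂μ) atTop (𝓝 (∫ p, f p * g p ∂μ)) := by
  refine tendsto_integral_of_L1' _ (hf.integrable_mul hg).1
    (Eventually.of_forall fun n => hf.integrable_mul (hgn n)) ?_
  have hlim : Tendsto (fun n => eLpNorm f 2 μ * eLpNorm (fun p => g p - gn n p) 2 μ) atTop
      (𝓝 0) := by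
    simpa using ENNReal.Tendsto.const_mul h (Or.inr hf.2.ne)
  refine tendsto_of_tendsto_of_tendsto_of_le_of_le tendsto_const_nhds hlim
    (fun _ => zero_le) fun n => ?_
  have := eLpNorm_smul_le_mul_eLpNorm (p := 2) (q := 2) (r := 1) (hg.sub (hgn n)).1 hf.1
  refine le_trans (le_of_eq ?_) this
  rw [← eLpNorm_neg]
  congr 1
  ext p
  simp [mul_sub]

theorem IsTest.fderiv_apply {φ : ℝ × ℝ → ℝ} (h : IsTest Ω φ) (v : ℝ × ℝ) :
    IsTest Ω (fun p => fderiv ℝ φ p v) where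
  smooth := (h.smooth.fderiv_right (m := ∞) (by simp)).clm_apply contDiff_const
  compact := h.compact.fderiv_apply ℝ v
  supp := (tsupport_fderiv_apply_subset ℝ v).trans h.supp

theorem IsTest.fderiv_fderiv_comm {φ : ℝ × ℝ → ℝ} (h : IsTest Ω φ) (p v w : ℝ × ℝ) :
    fderiv ℝ (fun p => fderiv ℝ φ p v) p w = fderiv ℝ (fun p => fderiv ℝ φ p w) p v := by
  have hd : DifferentiableAt ℝ (fderiv ℝ φ) p :=
    ((h.smooth.fderiv_right (m := ∞) (by simp)).differentiable (by simp)).differentiableAt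
  have hs : IsSymmSndFDerivAt ℝ φ p :=
    h.smooth.contDiffAt.isSymmSndFDerivAt
      (by simpa using WithTop.coe_le_coe.2 (le_top : (2 : ℕ∞) ≤ ⊤))
  rw [fderiv_clm_apply hd (by fun_prop), fderiv_clm_apply hd (by fun_prop)]
  simpa using hs.eq w v

/-- For a test function in place of `u`, both products integrate to minus the integral of `w`
against a mixed second derivative, and mixed derivatives commute. Density of test functions does the
rest; only `u` has to vanish on the boundary. -/
theorem integral_nullLagrangian (u w : Sobolev Ω) (hu : InW0 u) :
    ∫ p in Ω, (w.dy p * u.dx p - u.dy p * w.dx p) = 0 := by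
  obtain ⟨φ, hφ, -, hx, hy⟩ := hu
  have h1 := tendsto_integral_mul w.memLp_dy u.memLp_dx (fun n => (hφ n).memLp_fderiv _) hx
  have h2 := tendsto_integral_mul w.memLp_dx u.memLp_dy (fun n => (hφ n).memLp_fderiv _) hy
  have e : ∀ n, ∫ p in Ω, w.dy p * fderiv ℝ (φ n) p (1, 0)
      = ∫ p in Ω, w.dx p * fderiv ℝ (φ n) p (0, 1) := by
    intro n
    -- The weak derivatives of `w` are tested against first derivatives of `φ n`, which are
    -- themselves test functions.
    have a := w.weak_dy _ ((hφ n).fderiv_apply (1, 0))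
    have b := w.weak_dx _ ((hφ n).fderiv_apply (0, 1))
    simp only [(hφ n).fderiv_fderiv_comm _ (1, 0) (0, 1)] at a
    linarith
  simp only [e] at h1
  have h3 := tendsto_nhds_unique h1 h2
  have h4 : ∀ p, u.dy p * w.dx p = w.dx p * u.dy p := fun p => mul_comm _ _
  simp only [h4]
  exact (integral_sub (w.memLp_dy.integrable_mul u.memLp_dx)
    (w.memLp_dx.integrable_mul u.memLp_dy)).trans (sub_eq_zero.2 h3)

/-! ### The energy along a line -/

/-- The integrand of `J`. -/
def energyDensity (A B C L lam L₂ : ℝ) (q : Triple Ω) (p : ℝ × ℝ) : ℝ :=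
  elastic L₂ q p + lam ^ 2 / L * bulk A B C (q.q₁.val p) (q.q₂.val p) (q.q₃.val p)

/-- The components of `q` are in `L⁴(Ω)`. -/
structure Triple.MemLpFour (q : Triple Ω) : Prop where
  q₁ : MemLp q.q₁.val 4 (volume.restrict Ω)
  q₂ : MemLp q.q₂.val 4 (volume.restrict Ω)
  q₃ : MemLp q.q₃.val 4 (volume.restrict Ω)

theorem Triple.MemLpFour.perturb {q v : Triple Ω} (hq : q.MemLpFour) (hv : v.MemLpFour) (t : ℝ) :
    (q.perturb t v).MemLpFour :=
  ⟨hq.q₁.add (hv.q₁.const_mul t), hq.q₂.add (hv.q₂.const_mul t), hq.q₃.add (hv.q₃.const_mul t)⟩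

theorem memLp_two_sq {f : ℝ × ℝ → ℝ} {μ : Measure (ℝ × ℝ)} (hf : MemLp f 4 μ) :
    MemLp (fun p => f p ^ 2) 2 μ := by
  have h : ENNReal.HolderTriple 4 4 2 := ⟨by
    rw [← ENNReal.toReal_eq_toReal_iff' (by simp) (by simp), ENNReal.toReal_add (by simp) (by simp)]
    norm_num⟩
  simpa [sq] using hf.mul' hf

theorem integrable_elastic (L₂ : ℝ) (q : Triple Ω) :
    Integrable (elastic L₂ q) (volume.restrict Ω) := by
  have i {f g : ℝ × ℝ → ℝ} (hf : MemLp f 2 (volume.restrict Ω))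
    (hg : MemLp g 2 (volume.restrict Ω)) : Integrable (fun p => f p * g p) (volume.restrict Ω) :=
    hf.integrable_mul hg
  have x1 := q.q₁.memLp_dx
  have y1 := q.q₁.memLp_dy
  have x2 := q.q₂.memLp_dx
  have y2 := q.q₂.memLp_dy
  have x3 := q.q₃.memLp_dx
  have y3 := q.q₃.memLp_dy
  exact (((((x1.integrable_sq.add y1.integrable_sq).const_mul _).add
    ((x2.integrable_sq.add y2.integrable_sq).const_mul _)).add
    ((x3.integrable_sq.add y3.integrable_sq).const_mul _)).add
    (((((i y1 y3).sub (i x1 x3)).sub (i y2 x3)).sub (i x2 y3)).const_mul _)).add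
    (((i y2 x1).sub (i y1 x2)).const_mul _)

/-- Squares of `L⁴` functions lie in `L²`: the quartic bulk term is then the square of an `L²`
function and the cubic one a product of two `L²` functions. -/
theorem integrable_energyDensity (A B C L lam L₂ : ℝ) {q : Triple Ω} (hq : q.MemLpFour) :
    Integrable (energyDensity A B C L lam L₂ q) (volume.restrict Ω) := by
  refine (integrable_elastic L₂ q).add (Integrable.const_mul ?_ _)
  have h1 := memLp_two_sq hq.q₁
  have h2 := memLp_two_sq hq.q₂
  have h3 := memLp_two_sq hq.q₃
  have hs := (h1.add h2).add (h3.const_mul 3)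
  exact (((q.q₁.memLp_val.integrable_sq.add q.q₂.memLp_val.integrable_sq).add
    (q.q₃.memLp_val.integrable_sq.const_mul 3)).const_mul A |>.add
    (hs.integrable_sq.const_mul C)).add
    ((q.q₃.memLp_val.const_mul (2 * B)).integrable_mul ((h1.add h2).sub h3))

/-- The density of the second variation. -/
def secondVariationDensity (A B C L lam L₂ : ℝ) (q v : Triple Ω) (p : ℝ × ℝ) : ℝ :=
  2 * elastic L₂ v p + lam ^ 2 / L *
    (2 * A * (v.q₁.val p ^ 2 + v.q₂.val p ^ 2 + 3 * v.q₃.val p ^ 2)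
      + C * (8 * (q.q₁.val p * v.q₁.val p + q.q₂.val p * v.q₂.val p
            + 3 * q.q₃.val p * v.q₃.val p) ^ 2
          + 4 * (q.q₁.val p ^ 2 + q.q₂.val p ^ 2 + 3 * q.q₃.val p ^ 2)
            * (v.q₁.val p ^ 2 + v.q₂.val p ^ 2 + 3 * v.q₃.val p ^ 2))
      + 4 * B * (q.q₃.val p * (v.q₁.val p ^ 2 + v.q₂.val p ^ 2 - v.q₃.val p ^ 2)
          + 2 * v.q₃.val p * (q.q₁.val p * v.q₁.val p + q.q₂.val p * v.q₂.val p
            - q.q₃.val p * v.q₃.val p)))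

theorem iteratedDeriv_two_quartic (a b c d e : ℝ) :
    iteratedDeriv 2 (fun t : ℝ => a + b * t + c * t ^ 2 + d * t ^ 3 + e * t ^ 4) 0 = 2 * c := by
  have h1 : deriv (fun t : ℝ => a + b * t + c * t ^ 2 + d * t ^ 3 + e * t ^ 4)
      = fun t => b + c * (2 * t) + d * (3 * t ^ 2) + e * (4 * t ^ 3) := by
    funext t
    refine HasDerivAt.deriv ?_
    have := ((((hasDerivAt_id t).const_mul b).const_add a).fun_add
      ((hasDerivAt_pow 2 t).const_mul c)).add ((hasDerivAt_pow 3 t).const_mul d) |>.fun_add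
      ((hasDerivAt_pow 4 t).const_mul e)
    simpa using this
  rw [iteratedDeriv_succ, iteratedDeriv_one, h1]
  refine HasDerivAt.deriv ?_
  have := (((((hasDerivAt_id (0 : ℝ)).const_mul 2).const_mul c).const_add b).fun_add
      (((hasDerivAt_pow 2 (0 : ℝ)).const_mul 3).const_mul d)).fun_add
      (((hasDerivAt_pow 3 (0 : ℝ)).const_mul 4).const_mul e)
  simpa [mul_comm] using this

/-- The second variation of `J` exists and is the integral of its density. -/
theorem secondVariation (A B C L lam L₂ : ℝ) {q v : Triple Ω} (hq : q.MemLpFour)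
    (hv : v.MemLpFour) :
    ContDiffAt ℝ 2 (fun t : ℝ => J A B C L lam L₂ (q.perturb t v)) 0 ∧
    Integrable (secondVariationDensity A B C L lam L₂ q v) (volume.restrict Ω) ∧
    iteratedDeriv 2 (fun t : ℝ => J A B C L lam L₂ (q.perturb t v)) 0 =
      ∫ p in Ω, secondVariationDensity A B C L lam L₂ q v p := by
  set F : ℝ → ℝ × ℝ → ℝ := fun t => energyDensity A B C L lam L₂ (q.perturb t v) with hF
  have hi : ∀ t, Integrable (F t) (volume.restrict Ω) := fun t =>
    integrable_energyDensity A B C L lam L₂ (hq.perturb hv t)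
  -- A quartic in `t` is determined by its values at `0, ±1, ±2`. Writing its coefficients by
  -- interpolation makes them linear combinations of energy densities, so their integrability needs
  -- no term-by-term check.
  set c₁ : ℝ × ℝ → ℝ := fun p => (1 / 12) * (8 * (F 1 p - F (-1) p) - (F 2 p - F (-2) p)) with hc₁
  set c₂ : ℝ × ℝ → ℝ := fun p =>
    (1 / 24) * (16 * (F 1 p + F (-1) p) - (F 2 p + F (-2) p) - 30 * F 0 p) with hc₂
  set c₃ : ℝ × ℝ → ℝ := fun p => (1 / 12) * ((F 2 p - F (-2) p) - 2 * (F 1 p - F (-1) p)) with hc₃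
  set c₄ : ℝ × ℝ → ℝ := fun p =>
    (1 / 24) * ((F 2 p + F (-2) p) - 4 * (F 1 p + F (-1) p) + 6 * F 0 p) with hc₄
  have i₁ : Integrable c₁ (volume.restrict Ω) :=
    ((((hi 1).sub (hi (-1))).const_mul 8).sub ((hi 2).sub (hi (-2)))).const_mul _
  have i₂ : Integrable c₂ (volume.restrict Ω) :=
    (((((hi 1).add (hi (-1))).const_mul 16).sub ((hi 2).add (hi (-2)))).sub
      ((hi 0).const_mul 30)).const_mul _
  have i₃ : Integrable c₃ (volume.restrict Ω) :=
    (((hi 2).sub (hi (-2))).sub (((hi 1).sub (hi (-1))).const_mul 2)).const_mul _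
  have i₄ : Integrable c₄ (volume.restrict Ω) :=
    ((((hi 2).add (hi (-2))).sub (((hi 1).add (hi (-1))).const_mul 4)).add
      ((hi 0).const_mul 6)).const_mul _
  have hadd (u w : Sobolev Ω) (t : ℝ) (p : ℝ × ℝ) : (u + t • w).val p = u.val p + t * w.val p ∧
    (u + t • w).dx p = u.dx p + t * w.dx p ∧ (u + t • w).dy p = u.dy p + t * w.dy p :=
    ⟨rfl, rfl, rfl⟩
  have hexp : ∀ t p, F t p = F 0 p + c₁ p * t + c₂ p * t ^ 2 + c₃ p * t ^ 3 + c₄ p * t ^ 4 := by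
    intro t p
    simp only [hc₁, hc₂, hc₃, hc₄, hF, energyDensity, elastic, bulk, Triple.perturb, hadd]
    ring
  have hsecond : ∀ p, secondVariationDensity A B C L lam L₂ q v p = 2 * c₂ p := by
    intro p
    simp only [hc₂, hF, energyDensity, secondVariationDensity, elastic, bulk, Triple.perturb, hadd]
    ring
  have hJ : (fun t : ℝ => J A B C L lam L₂ (q.perturb t v)) = fun t =>
      (∫ p in Ω, F 0 p) + (∫ p in Ω, c₁ p) * t + (∫ p in Ω, c₂ p) * t ^ 2
        + (∫ p in Ω, c₃ p) * t ^ 3 + (∫ p in Ω, c₄ p) * t ^ 4 := by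
    funext t
    have e : J A B C L lam L₂ (q.perturb t v) = ∫ p in Ω, F t p := rfl
    rw [e]
    simp only [hexp t]
    rw [integral_add, integral_add, integral_add, integral_add, integral_mul_const,
      integral_mul_const, integral_mul_const, integral_mul_const]
    · exact hi 0
    · exact i₁.mul_const _
    · exact (hi 0).add (i₁.mul_const _)
    · exact i₂.mul_const _
    · exact ((hi 0).add (i₁.mul_const _)).add (i₂.mul_const _)
    · exact i₃.mul_const _
    · exact (((hi 0).add (i₁.mul_const _)).add (i₂.mul_const _)).add (i₃.mul_const _)
    · exact i₄.mul_const _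
  rw [hJ]
  refine ⟨by fun_prop, ?_, ?_⟩
  · rw [show secondVariationDensity A B C L lam L₂ q v = fun p => 2 * c₂ p from funext hsecond]
    exact i₂.const_mul 2
  · rw [iteratedDeriv_two_quartic]
    simp only [hsecond, integral_const_mul]

/-! ### Admissible triples -/

theorem isBounded_truncSq (ε : ℝ) : Bornology.IsBounded (truncSq ε) :=
  (Metric.isBounded_closedBall (x := 0) (r := 1)).subset fun p hp => by
    simpa using norm_le_of_mem_truncSq hp

theorem memLp_ofLipschitz (ε : ℝ) (f : ℝ × ℝ → ℝ) (hf : ∃ K : ℝ≥0, LipschitzWith K f)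
    (r : ENNReal) : MemLp (ofLipschitz ε f hf).val r (volume.restrict (truncSq ε)) := by
  have hfin : IsFiniteMeasure (volume.restrict (truncSq ε)) :=
    ⟨by simpa using volume_truncSq_lt_top ε⟩
  obtain ⟨K, hK⟩ := hf
  obtain ⟨R, hR⟩ := (isCompact_closedBall (0 : ℝ × ℝ) 1).exists_bound_of_continuousOn
    hK.continuous.continuousOn
  refine MemLp.of_bound hK.continuous.aestronglyMeasurable R ?_
  filter_upwards [ae_restrict_mem (isOpen_truncSq ε).measurableSet] with p hp
  exact hR p (by simpa using norm_le_of_mem_truncSq hp)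

/-- Split `u = (u - w) + w`, where `u - w` is in `L⁴` by the Sobolev embedding. -/
theorem EqOnBoundary.memLp_four (hb : Bornology.IsBounded Ω)
    {u w : Sobolev Ω} (h : EqOnBoundary u w) (hw : MemLp w.val 4 (volume.restrict Ω)) :
    MemLp u.val 4 (volume.restrict Ω) := by
  have h1 : MemLp (fun p => u.val p + (-1) * w.val p) 4 (volume.restrict Ω) :=
    InW0.memLp_four hb h
  refine (h1.add hw).ae_eq (Eventually.of_forall fun p => ?_)
  simp

theorem memLpFour_of_mem_A0 {A B C ε : ℝ} {q : Triple (truncSq ε)} (hq : q ∈ A0 A B C ε) :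
    q.MemLpFour where
  q₁ := hq.1.memLp_four (isBounded_truncSq ε)
    (memLp_ofLipschitz ε _ _ 4)
  q₂ := hq.2.1.memLp_four (isBounded_truncSq ε)
    (memLp_ofLipschitz ε _ _ 4)
  q₃ := hq.2.2.memLp_four (isBounded_truncSq ε)
    (memLp_ofLipschitz ε _ _ 4)

/-! ### Stability -/

/-- A lower bound for the curvature of the bulk density is `-bulkConst A B C`. -/
def bulkConst (A B C : ℝ) : ℝ := 6 * |A| + B ^ 2 / (3 * C)

theorem bulkConst_nonneg (A B : ℝ) {C : ℝ} (hC : 0 < C) : 0 ≤ bulkConst A B C := by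
  unfold bulkConst; positivity

theorem memLp_zero_val (r : ENNReal) : MemLp (0 : Sobolev Ω).val r (volume.restrict Ω) :=
  MemLp.zero

/-- With `c = q₃`, the `c`-dependent bulk coefficient is `12 C c² + 4 B c ≥ -B²/(3C)`; the other
quartic contributions are nonnegative. The null Lagrangian has no sign pointwise and is kept for
integration. -/
theorem inPlane_density_ge {A B C L lam L₂ : ℝ} (hC : 0 < C) (hL : 0 < L) (hL₂ : 0 ≤ L₂)
    (q : Triple Ω) (v₁ v₂ : Sobolev Ω) (p : ℝ × ℝ) :
    (2 + L₂) * ((v₁.dx p ^ 2 + v₁.dy p ^ 2) + (v₂.dx p ^ 2 + v₂.dy p ^ 2))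
      + 2 * L₂ * (v₂.dy p * v₁.dx p - v₁.dy p * v₂.dx p)
      - lam ^ 2 / L * bulkConst A B C * (v₁.val p ^ 2 + v₂.val p ^ 2)
      ≤ secondVariationDensity A B C L lam L₂ q ⟨v₁, v₂, 0⟩ p := by
  have z1 : (0 : Sobolev Ω).val p = 0 := rfl
  have z2 : (0 : Sobolev Ω).dx p = 0 := rfl
  have z3 : (0 : Sobolev Ω).dy p = 0 := rfl
  simp only [secondVariationDensity, elastic, bulkConst, z1, z2, z3, abs_of_nonneg hL₂]
  set a := q.q₁.val p
  set b := q.q₂.val p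
  set c := q.q₃.val p
  set x := v₁.val p
  set y := v₂.val p
  have hA := neg_abs_le A
  have e : B ^ 2 / (3 * C) + 4 * B * c + 12 * C * c ^ 2 = (6 * C * c + B) ^ 2 / (3 * C) := by
    field_simp
    ring
  have hs : 0 ≤ x ^ 2 + y ^ 2 := by positivity
  have k1 : 0 ≤ (6 * C * c + B) ^ 2 / (3 * C) * (x ^ 2 + y ^ 2) := by positivity
  have k2 : 0 ≤ 8 * C * (a * x + b * y) ^ 2 := by positivity
  have k3 : 0 ≤ 4 * C * ((a ^ 2 + b ^ 2) * (x ^ 2 + y ^ 2)) := by positivity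
  -- Here `2 |A|` would suffice; `6 |A|` is what the out-of-plane case requires, and one constant
  -- serves both.
  have k4 : 0 ≤ (6 * |A| + 2 * A) * (x ^ 2 + y ^ 2) :=
    mul_nonneg (by linarith [abs_nonneg A]) hs
  rw [← e] at k1
  have key := mul_nonneg (by positivity : 0 ≤ lam ^ 2 / L) (add_nonneg (add_nonneg k1 k2)
    (add_nonneg k3 k4))
  linear_combination key

/-- The `c`-dependent bulk coefficient is now `108 C c² - 12 B c`, whose minimum is again
`-B²/(3C)`. The true elastic coefficient is `6 + L₂`; the surplus `4` is discarded to match the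
in-plane bound. -/
theorem outOfPlane_density_ge {A B C L lam L₂ : ℝ} (hC : 0 < C) (hL : 0 < L) (hL₂ : 0 ≤ L₂)
    (q : Triple Ω) (v : Sobolev Ω) (p : ℝ × ℝ) :
    (2 + L₂) * (v.dx p ^ 2 + v.dy p ^ 2) - lam ^ 2 / L * bulkConst A B C * v.val p ^ 2
      ≤ secondVariationDensity A B C L lam L₂ q ⟨0, 0, v⟩ p := by
  have z1 : (0 : Sobolev Ω).val p = 0 := rfl
  have z2 : (0 : Sobolev Ω).dx p = 0 := rfl
  have z3 : (0 : Sobolev Ω).dy p = 0 := rfl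
  simp only [secondVariationDensity, elastic, bulkConst, z1, z2, z3, abs_of_nonneg hL₂]
  set a := q.q₁.val p
  set b := q.q₂.val p
  set c := q.q₃.val p
  set x := v.val p
  have hA := neg_abs_le A
  have e : B ^ 2 / (3 * C) - 12 * B * c + 108 * C * c ^ 2 = (18 * C * c - B) ^ 2 / (3 * C) := by
    field_simp
    ring
  have k0 : 0 ≤ v.dx p ^ 2 + v.dy p ^ 2 := by positivity
  have k1 : 0 ≤ (18 * C * c - B) ^ 2 / (3 * C) * x ^ 2 := by positivity
  have k3 : 0 ≤ 12 * C * ((a ^ 2 + b ^ 2) * x ^ 2) := by positivity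
  have k4 : 0 ≤ (6 * |A| + 6 * A) * x ^ 2 := mul_nonneg (by linarith) (sq_nonneg _)
  rw [← e] at k1
  have key := mul_nonneg (by positivity : 0 ≤ lam ^ 2 / L) (add_nonneg k1 (add_nonneg k3 k4))
  linear_combination key + 4 * k0

theorem integrable_gradSq (u : Sobolev Ω) :
    Integrable (fun p => u.dx p ^ 2 + u.dy p ^ 2) (volume.restrict Ω) :=
  u.memLp_dx.integrable_sq.add u.memLp_dy.integrable_sq

theorem stableInPlane_of_le {A B C L lam L₂ P : ℝ}
    (hb : Bornology.IsBounded Ω) (hC : 0 < C) (hL : 0 < L) (hL₂ : 0 ≤ L₂)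
    (hP : ∀ u : Sobolev Ω, InW0 u → ∫ p in Ω, u.val p ^ 2 ≤ P * dirichlet u)
    (hle : lam ^ 2 / L * bulkConst A B C * P ≤ L₂) {q : Triple Ω} (hq : q.MemLpFour) :
    StableInPlane A B C L lam L₂ q := by
  intro v₁ v₂ h₁ h₂ hne
  obtain ⟨hd, hi, he⟩ := secondVariation A B C L lam L₂ hq (v := ⟨v₁, v₂, 0⟩)
    ⟨h₁.memLp_four hb, h₂.memLp_four hb, memLp_zero_val 4⟩
  refine ⟨hd, ?_⟩
  rw [he]
  have g : Integrable (fun p => (v₁.dx p ^ 2 + v₁.dy p ^ 2) + (v₂.dx p ^ 2 + v₂.dy p ^ 2))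
    (volume.restrict Ω) := (integrable_gradSq v₁).add (integrable_gradSq v₂)
  have n : Integrable (fun p => v₂.dy p * v₁.dx p - v₁.dy p * v₂.dx p) (volume.restrict Ω) :=
    (v₂.memLp_dy.integrable_mul v₁.memLp_dx).sub (v₁.memLp_dy.integrable_mul v₂.memLp_dx)
  have s : Integrable (fun p => v₁.val p ^ 2 + v₂.val p ^ 2) (volume.restrict Ω) :=
    v₁.memLp_val.integrable_sq.add v₂.memLp_val.integrable_sq
  have hmono := integral_mono (((g.const_mul (2 + L₂)).add (n.const_mul (2 * L₂))).sub
    (s.const_mul (lam ^ 2 / L * bulkConst A B C))) hi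
    (inPlane_density_ge hC hL hL₂ q v₁ v₂)
  refine lt_of_lt_of_le ?_ hmono
  rw [integral_sub' ((g.const_mul _).add (n.const_mul _)) (s.const_mul _),
    integral_add' (g.const_mul _) (n.const_mul _), integral_const_mul, integral_const_mul,
    integral_const_mul, integral_nullLagrangian v₁ v₂ h₁,
    integral_add (integrable_gradSq v₁) (integrable_gradSq v₂),
    integral_add v₁.memLp_val.integrable_sq v₂.memLp_val.integrable_sq]
  change 0 < (2 + L₂) * (dirichlet v₁ + dirichlet v₂) + _ - _
  have p1 := dirichlet_nonneg v₁
  have p2 := dirichlet_nonneg v₂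
  have hpos : 0 < dirichlet v₁ + dirichlet v₂ := by
    rcases not_and_or.1 hne with h | h
    · linarith [dirichlet_pos_of_not_aeZero hb h₁ h]
    · linarith [dirichlet_pos_of_not_aeZero hb h₂ h]
  have hK : 0 ≤ lam ^ 2 / L * bulkConst A B C :=
    mul_nonneg (by positivity) (bulkConst_nonneg A B hC)
  -- Poincaré turns the bulk loss into a multiple of the Dirichlet energy, which the `L₂` part of `2
  -- + L₂` covers; the `2` gives strict positivity.
  have b1 := mul_le_mul_of_nonneg_left (add_le_add (hP v₁ h₁) (hP v₂ h₂)) hK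
  have b2 := mul_le_mul_of_nonneg_right hle hpos.le
  linarith

theorem stableOutOfPlane_of_le {A B C L lam L₂ P : ℝ}
    (hb : Bornology.IsBounded Ω) (hC : 0 < C) (hL : 0 < L) (hL₂ : 0 ≤ L₂)
    (hP : ∀ u : Sobolev Ω, InW0 u → ∫ p in Ω, u.val p ^ 2 ≤ P * dirichlet u)
    (hle : lam ^ 2 / L * bulkConst A B C * P ≤ L₂) {q : Triple Ω} (hq : q.MemLpFour) :
    StableOutOfPlane A B C L lam L₂ q := by
  intro v hv hne
  obtain ⟨hd, hi, he⟩ := secondVariation A B C L lam L₂ hq (v := ⟨0, 0, v⟩)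
    ⟨memLp_zero_val 4, memLp_zero_val 4, hv.memLp_four hb⟩
  refine ⟨hd, ?_⟩
  rw [he]
  have g := integrable_gradSq v
  have s := v.memLp_val.integrable_sq
  have hmono := integral_mono ((g.const_mul (2 + L₂)).sub
    (s.const_mul (lam ^ 2 / L * bulkConst A B C))) hi (outOfPlane_density_ge hC hL hL₂ q v)
  refine lt_of_lt_of_le ?_ hmono
  rw [integral_sub' (g.const_mul _) (s.const_mul _), integral_const_mul, integral_const_mul]
  change 0 < (2 + L₂) * dirichlet v - _
  have hpos := dirichlet_pos_of_not_aeZero hb hv hne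
  have hK : 0 ≤ lam ^ 2 / L * bulkConst A B C :=
    mul_nonneg (by positivity) (bulkConst_nonneg A B hC)
  have b1 := mul_le_mul_of_nonneg_left (hP v hv) hK
  have b2 := mul_le_mul_of_nonneg_right hle hpos.le
  linarith

end LdG

end

theorem proposition5p1 (M₁ M₂ M₃ : ℝ → ℝ → ℝ → ℝ) :
    ∃ c : ℝ → ℝ → ℝ → ℝ → ℝ, ∀ A B C ε : ℝ, A < 0 → 0 < B → 0 < C → 0 < ε → ε < 1 →
      0 < c A B C ε ∧
      ∀ L lam L₂ : ℝ, 0 < L → 0 < lam → lam ^ 2 / L * c A B C ε ≤ L₂ →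
        ∀ q : LdG.Triple (LdG.truncSq ε),
          q ∈ LdG.AStar A B C ε (M₁ A B C) (M₂ A B C) (M₃ A B C) →
          LdG.IsCritical A B C L lam L₂ q →
          LdG.StableInPlane A B C L lam L₂ q ∧ LdG.StableOutOfPlane A B C L lam L₂ q := by
  choose P hP0 hP using fun ε : ℝ =>
    LdG.exists_poincare (LdG.isBounded_truncSq ε)
  -- The product `K P` already suffices for stability; adding `1` makes the constant strictly
  -- positive even if the chosen `P ε` is zero.
  refine ⟨fun A B C ε => LdG.bulkConst A B C * P ε + 1, fun A B C ε _ _ hC _ _ => ?_⟩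
  have hnn : 0 ≤ LdG.bulkConst A B C * P ε := mul_nonneg (LdG.bulkConst_nonneg A B hC) (hP0 ε)
  refine ⟨by positivity, fun L lam L₂ hL _ hle q hq _ => ?_⟩
  have hmu : 0 ≤ lam ^ 2 / L := by positivity
  have hL₂ : 0 ≤ L₂ := (mul_nonneg hmu (by positivity)).trans hle
  have hle' : lam ^ 2 / L * LdG.bulkConst A B C * P ε ≤ L₂ := by linarith
  have hq4 := LdG.memLpFour_of_mem_A0 hq.1
  exact ⟨LdG.stableInPlane_of_le (LdG.isBounded_truncSq ε)
      hC hL hL₂ (hP ε) hle' hq4,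
    LdG.stableOutOfPlane_of_le (LdG.isBounded_truncSq ε)
      hC hL hL₂ (hP ε) hle' hq4⟩
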